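/- Let $G$ be a group, let $A$ be a finite set with a map $A\to G$, let $\pi\colon A^*\to G$ be the induced homomorphism from the free monoid on $A$, and suppose that $\pi$ is surjective, that $\pi(A)=\pi(A)^{-1}$ and that $1_G\in\pi(A)$. Let $d_A$ be the combinatorial metric on the Cayley graph of $G$ with respect to $A$. For a path $p$ in the Cayley graph, let $\hat p(t)$ be its $t$-th vertex if $0\le t\le |p|$, and its final vertex if $t>|p|$ or $t=\infty$. Let $\mathcal L\subseteq A^*$ be such that $(A,\mathcal L)$ is a uniformly finite-to-one biautomatic structure on $G$, that is: (i) $\mathcal L$ is recognised by a finite state automaton over $A$; (ii) there is $N\ge 1$ such that $1\le |\pi^{-1}(g)\cap\mathcal L|\le N$ for every $g\in G$; (iii) there is $\zeta\ge 1$ such that if $p,q$ are paths in the Cayley graph labelled by words in $\mathcal L$ with $d_A(\hat p(0),\hat q(0))\le 1$ and $d_A(\hat p(\infty),\hat q(\infty))\le 1$, then $d_A(\hat p(t),\hat q(t))\le\zeta$ for all $t\ge 0$. Let $g\in G$, and for each $n\ge 1$ let $w_n\in\mathcal L$ be any word representing $g^n$ (that is, $\pi(w_n)=g^n$). Then the sequence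 $(|w_n|/n)_{n\ge 1}$ converges and its limit is a rational number. Consequently, writing $|h|_{\mathcal L}$ for the length of a shortest word in $\mathcal L$ representing $h\in G$, the stable $\mathcal L$-word length $\tau_{\mathcal L}(g):=\lim_{n\to\infty}|g^n|_{\mathcal L}/n$ exists, is rational, and equals $\lim_{n\to\infty}|w_n|/n$ for every choice of the words $w_n$. -/

import Mathlib

open Filter Topology
open scoped Pointwise

namespace Biaut

universe u v

variable {G : Type u} [Group G] {A : Type v}

/-- The element of `G` labelled by a word in the free monoid on `A`, for a map `ev : A → G`. -/
def wordEval (ev : A → G) (w : List A) : G := (w.map ev).prod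

/-- The combinatorial metric on the Cayley graph of `G` with respect to `ev : A → G`
(edges join `x` to `x * ev a`). -/
noncomputable def cayleyDist (ev : A → G) (x y : G) : ℕ :=
  (SimpleGraph.mulCayley (Set.range ev)).dist x y

/-- The `t`-th vertex of the path in the Cayley graph that starts at `x` and is labelled by `w`;
it is the final vertex of the path when `t` exceeds the length of `w`. -/
def pathVertex (ev : A → G) (x : G) (w : List A) (t : ℕ) : G := x * wordEval ev (w.take t)

/-- The final vertex of the path in the Cayley graph that starts at `x` and is labelled by `w`. -/
def pathEnd (ev : A → G) (x : G) (w : List A) : G := x * wordEval ev w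

/-- `(A, L)` is a uniformly finite-to-one biautomatic structure on `G`; the finite set `A` is
regarded as a generating set through `ev : A → G`. -/
structure IsBiautomaticStructure (ev : A → G) (L : Language A) : Prop where
  finite : Finite A
  /-- `A` generates `G` as a monoid -/
  generates : Function.Surjective (wordEval ev)
  symmetric : (Set.range ev)⁻¹ = Set.range ev
  one_mem : (1 : G) ∈ Set.range ev
  /-- `L` is recognised by a finite state automaton over `A` -/
  regular : L.IsRegular
  finite_to_one : ∃ N : ℕ, 1 ≤ N ∧ ∀ g : G,
    1 ≤ {w : List A | w ∈ L ∧ wordEval ev w = g}.encard ∧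
      {w : List A | w ∈ L ∧ wordEval ev w = g}.encard ≤ N
  /-- the two-sided fellow traveller property -/
  fellow_traveller : ∃ ζ : ℕ, 1 ≤ ζ ∧ ∀ p ∈ L, ∀ q ∈ L, ∀ x y : G,
    cayleyDist ev x y ≤ 1 →
    cayleyDist ev (pathEnd ev x p) (pathEnd ev y q) ≤ 1 →
    ∀ t : ℕ, cayleyDist ev (pathVertex ev x p t) (pathVertex ev y q t) ≤ ζ

/-- The `L`-word length of `g`: the length of a shortest word in `L` representing `g`. -/
noncomputable def wordLength (ev : A → G) (L : Language A) (g : G) : ℕ :=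
  sInf {n : ℕ | ∃ w ∈ L, wordEval ev w = g ∧ w.length = n}

/-- The stable `L`-word length of `g`: the limit of `|gⁿ|_L / n`. -/
noncomputable def stableLength (ev : A → G) (L : Language A) (g : G) : ℝ :=
  limUnder atTop fun n : ℕ => (wordLength ev L (g ^ n) : ℝ) / n

end Biaut

namespace Biaut

/-! ### Evaluation of words and of repeated loops. -/

section Words

variable {G : Type*} [Group G] {A : Type*} (ev : A → G)

/-! Some finite `S` in the centralizer of `g` has commutative centralizer: biautomaticity makes the
centralizer of `g` finitely generated, and generators together with `g` serve as `S`. Along a word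
of `L` for `g ^ n`, the conjugates of each `s ∈ S` by the prefixes stay in a finite set, as `s`
commutes with `g ^ n`. Recording state, conjugates and letter turns these words into words over one
finite alphabet, and Higman's lemma gives `i < j` such that the run for `g ^ i` is a subsequence of
the run for `g ^ j`. The second word is thus the first with automaton loops inserted, each acting as
left multiplication by an element centralizing `S`. These elements commute, so repeating every loop
`k` times represents `g ^ (i + k * (j - i))` with length affine in `k`. Other words and exponents
change the length by a bounded amount, so lengths are `n * r + O(1)` with `r` rational. -/

@[simp] lemma wordEval_nil : wordEval ev [] = 1 := rfl

@[simp] lemma wordEval_cons (a : A) (w : List A) :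
    wordEval ev (a :: w) = ev a * wordEval ev w := by
  simp [wordEval]

@[simp] lemma wordEval_append (v w : List A) :
    wordEval ev (v ++ w) = wordEval ev v * wordEval ev w := by
  simp [wordEval]

lemma wordEval_flatten_replicate (w : List A) (k : ℕ) :
    wordEval ev (List.replicate k w).flatten = wordEval ev w ^ k := by
  induction k with
  | zero => simp
  | succ k ih => rw [List.replicate_succ, List.flatten_cons, wordEval_append, ih, pow_succ']

lemma evalFrom_flatten_replicate {σ : Type*} (M : DFA A σ) {s : σ} {w : List A}
    (h : M.evalFrom s w = s) (k : ℕ) : M.evalFrom s (List.replicate k w).flatten = s := by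
  induction k with
  | zero => simp
  | succ k ih => rw [List.replicate_succ, List.flatten_cons, DFA.evalFrom_of_append, h, ih]

lemma length_flatten_replicate (w : List A) (k : ℕ) :
    (List.replicate k w).flatten.length = k * w.length := by
  simp

end Words

/-! ### Fellow travelling, length comparison and centralizers. -/

section FellowTraveller

variable {G : Type*} [Group G] {A : Type*} {ev : A → G} {L : Language A}

lemma reachable_mul_wordEval (x : G) (w : List A) :
    (SimpleGraph.mulCayley (Set.range ev)).Reachable x (x * wordEval ev w) := by
  induction w generalizing x with
  | nil => simp
  | cons a w ih =>
    rw [wordEval_cons, ← mul_assoc]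
    refine SimpleGraph.Reachable.trans ?_ (ih (x * ev a))
    by_cases h : x = x * ev a
    · rw [← h]
    · exact SimpleGraph.Adj.reachable
        ((SimpleGraph.mulCayley_adj' _ _ _).2 ⟨h, ev a, ⟨a, rfl⟩, Or.inl rfl⟩)

lemma exists_word_of_walk (hsymm : (Set.range ev)⁻¹ = Set.range ev) {x y : G}
    (p : (SimpleGraph.mulCayley (Set.range ev)).Walk x y) :
    ∃ w : List A, w.length = p.length ∧ x * wordEval ev w = y := by
  induction p with
  | nil => exact ⟨[], by simp⟩
  | @cons x y z hadj p ih =>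
    obtain ⟨w, hw, hwy⟩ := ih
    obtain ⟨-, s, hs, h⟩ := (SimpleGraph.mulCayley_adj' _ _ _).1 hadj
    have : ∃ a : A, x * ev a = y := by
      rcases h with h | h
      · obtain ⟨a, rfl⟩ := hs
        exact ⟨a, h⟩
      · rw [← hsymm] at hs
        obtain ⟨a, ha⟩ := hs
        exact ⟨a, by rw [ha, h]; group⟩
    obtain ⟨a, ha⟩ := this
    exact ⟨a :: w, by simp [hw], by rw [wordEval_cons, ← mul_assoc, ha, hwy]⟩

lemma cayleyDist_mul_le_one (x : G) (a : A) : cayleyDist ev x (x * ev a) ≤ 1 := by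
  by_cases h : x = x * ev a
  · rw [← h]; simp [cayleyDist]
  · have hadj : (SimpleGraph.mulCayley (Set.range ev)).Adj x (x * ev a) :=
      (SimpleGraph.mulCayley_adj' _ _ _).2 ⟨h, ev a, ⟨a, rfl⟩, Or.inl rfl⟩
    exact (SimpleGraph.dist_eq_one_iff_adj.2 hadj).le

lemma IsBiautomaticStructure.finite_ball (hL : IsBiautomaticStructure ev L) (r : ℕ) :
    ∃ E : Set G, E.Finite ∧ ∀ x y : G, cayleyDist ev x y ≤ r → x⁻¹ * y ∈ E := by
  have := hL.finite
  refine ⟨wordEval ev '' {w | w.length ≤ r}, (List.finite_length_le A r).image _,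
    fun x y h => ?_⟩
  obtain ⟨v, hv⟩ := hL.generates (x⁻¹ * y)
  have hr : (SimpleGraph.mulCayley (Set.range ev)).Reachable x y := by
    have := reachable_mul_wordEval (ev := ev) x v
    rwa [hv, mul_inv_cancel_left] at this
  obtain ⟨p, hp⟩ := hr.exists_walk_length_eq_dist
  obtain ⟨w, hw, rfl⟩ := exists_word_of_walk hL.symmetric p
  exact ⟨w, by rw [Set.mem_ofPred_eq, hw, hp]; exact h, by group⟩

lemma IsBiautomaticStructure.exists_word (hL : IsBiautomaticStructure ev L) (h : G) :
    ∃ w ∈ L, wordEval ev w = h := by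
  obtain ⟨N, -, hN⟩ := hL.finite_to_one
  obtain ⟨w, hw⟩ := Set.one_le_encard_iff_nonempty.1 (hN h).1
  exact ⟨w, hw.1, hw.2⟩

variable (ev L) in
/-- Any two words `p, q ∈ L` labelling paths whose initial vertices differ by `h` and whose
terminal vertices differ by `h'` synchronously fellow travel within a finite set. -/
def FellowTravels (h h' : G) : Prop :=
  ∃ E : Set G, E.Finite ∧ ∀ p ∈ L, ∀ q ∈ L, h * wordEval ev q = wordEval ev p * h' →
    ∀ t : ℕ, (wordEval ev (p.take t))⁻¹ * h * wordEval ev (q.take t) ∈ E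

/-- Interpolate a third word of `L`, starting at `h₁` and ending at `h₁'` past the end of `p`; the
two differences multiply. -/
lemma FellowTravels.mul (hL : IsBiautomaticStructure ev L) {h₁ h₁' h₂ h₂' : G}
    (H₁ : FellowTravels ev L h₁ h₁') (H₂ : FellowTravels ev L h₂ h₂') :
    FellowTravels ev L (h₁ * h₂) (h₁' * h₂') := by
  obtain ⟨E₁, hE₁, H₁⟩ := H₁
  obtain ⟨E₂, hE₂, H₂⟩ := H₂
  refine ⟨E₁ * E₂, hE₁.mul hE₂, fun p hp q hq hpq t => ?_⟩
  obtain ⟨r, hr, hre⟩ := hL.exists_word (h₁⁻¹ * wordEval ev p * h₁')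
  have h1 := H₁ p hp r hr (by rw [hre]; group) t
  have h2 := H₂ r hr q hq (by
    rw [hre, mul_assoc _ h₁' h₂', mul_assoc, ← hpq]; group) t
  have := Set.mul_mem_mul h1 h2
  convert this using 1
  group

lemma fellowTravels_letter (hL : IsBiautomaticStructure ev L) (a b : A) :
    FellowTravels ev L (ev a) (ev b) := by
  obtain ⟨ζ, -, hζ⟩ := hL.fellow_traveller
  obtain ⟨E, hE, hball⟩ := hL.finite_ball ζ
  refine ⟨E, hE, fun p hp q hq hpq t => ?_⟩
  have h := hball _ _ (hζ p hp q hq 1 (ev a)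
    (by simpa using cayleyDist_mul_le_one (ev := ev) 1 a)
    (by simpa [pathEnd, hpq] using cayleyDist_mul_le_one (ev := ev) (wordEval ev p) b) t)
  simpa [pathVertex, mul_assoc] using h

/-- A letter of value `1` lets one endpoint move while the other stays fixed, so both can be moved
letter by letter. -/
theorem fellowTravels (hL : IsBiautomaticStructure ev L) (h h' : G) :
    FellowTravels ev L h h' := by
  obtain ⟨e, he⟩ := hL.one_mem
  have hleft : ∀ w : List A, FellowTravels ev L (wordEval ev w) 1 := by
    intro w
    induction w with
    | nil => simpa [he] using fellowTravels_letter hL e e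
    | cons a w ih => simpa [he] using (fellowTravels_letter hL a e).mul hL ih
  have hright : ∀ w : List A, FellowTravels ev L 1 (wordEval ev w) := by
    intro w
    induction w with
    | nil => simpa [he] using fellowTravels_letter hL e e
    | cons a w ih => simpa [he] using (fellowTravels_letter hL e a).mul hL ih
  obtain ⟨w, rfl⟩ := hL.generates h
  obtain ⟨w', rfl⟩ := hL.generates h'
  simpa using (hleft w).mul hL (hright w')

/-- Since `L` is finite-to-one, an accepted word has no nontrivial loop in the automaton which
represents the identity. -/
lemma loop_eq_nil_of_wordEval_eq_one (hL : IsBiautomaticStructure ev L) {σ : Type*}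
    {M : DFA A σ} (hM : M.accepts = L) {x u y : List A} (hmem : x ++ u ++ y ∈ L)
    (hloop : M.eval (x ++ u) = M.eval x) (hu : wordEval ev u = 1) : u = [] := by
  by_contra hne
  obtain ⟨N, -, hN⟩ := hL.finite_to_one
  have hfin : {w : List A | w ∈ L ∧ wordEval ev w = wordEval ev (x ++ y)}.Finite :=
    Set.finite_of_encard_le_coe (hN _).2
  have hloop' : M.evalFrom (M.eval x) u = M.eval x := by
    simpa only [DFA.eval, DFA.evalFrom_of_append] using hloop
  let f : ℕ → List A := fun k => x ++ (List.replicate k u).flatten ++ y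
  have hinj : Function.Injective f := by
    intro k l hkl
    have := congrArg List.length hkl
    simp only [f, List.length_append, length_flatten_replicate] at this
    have hpos : 0 < u.length := List.length_pos_iff.2 hne
    exact Nat.eq_of_mul_eq_mul_right hpos (by omega)
  refine Set.infinite_of_injective_forall_mem hinj (fun k => ?_) hfin
  refine ⟨?_, by simp [f, wordEval_flatten_replicate, hu]⟩
  rw [← hM, DFA.mem_accepts] at hmem ⊢
  simp only [DFA.eval, f, DFA.evalFrom_of_append] at hmem hloop' ⊢
  rw [evalFrom_flatten_replicate M hloop']
  rwa [hloop'] at hmem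

/-- After time `q.length` the path of `q` is stationary, so a much longer `p` would repeat both a
state and a vertex, giving a forbidden loop. -/
theorem exists_length_le_add (hL : IsBiautomaticStructure ev L) (h h' : G) :
    ∃ C : ℕ, ∀ p ∈ L, ∀ q ∈ L, h * wordEval ev q = wordEval ev p * h' →
      p.length ≤ q.length + C := by
  obtain ⟨σ, _, M, hM⟩ := hL.regular
  obtain ⟨E, hE, hFT⟩ := fellowTravels hL h h'
  have : Fintype E := hE.fintype
  refine ⟨Fintype.card (σ × E), fun p hp q hq hpq => ?_⟩
  by_contra! hlt
  let f : Fin (Fintype.card (σ × E) + 1) → σ × E := fun i =>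
    (M.eval (p.take (q.length + i)), ⟨_, hFT p hp q hq hpq (q.length + i)⟩)
  obtain ⟨i, j, hij, hf⟩ : ∃ i j, i < j ∧ f i = f j := by
    obtain ⟨i, j, hne, hf⟩ := Fintype.exists_ne_map_eq_of_card_lt f (by simp)
    rcases lt_or_gt_of_ne hne with h | h
    · exact ⟨i, j, h, hf⟩
    · exact ⟨j, i, h, hf.symm⟩
  simp only [f, Prod.mk.injEq, Subtype.mk.injEq] at hf
  obtain ⟨hs, hv⟩ := hf
  rw [List.take_of_length_le (l := q) (by omega), List.take_of_length_le (l := q) (by omega)]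
    at hv
  have hv' := inv_injective (mul_right_cancel (mul_right_cancel hv))
  have hij' : (i : ℕ) < j := hij
  have hj := j.2
  obtain ⟨x, u, y, hx, hxu, hxuy, hlen⟩ : ∃ x u y : List A,
      p.take (q.length + i) = x ∧ p.take (q.length + j) = x ++ u ∧ p = x ++ u ++ y ∧
        u.length = j - i := by
    refine ⟨p.take (q.length + i), (p.drop (q.length + i)).take (j - i),
      p.drop (q.length + j), rfl, ?_, ?_, ?_⟩
    · rw [← List.take_add]; congr 1; omega
    · rw [← List.take_add, show q.length + (i : ℕ) + (j - i) = q.length + j by omega,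
        List.take_append_drop]
    · rw [List.length_take, List.length_drop]; omega
  have hu : wordEval ev u = 1 := by
    rw [hx, hxu, wordEval_append] at hv'
    exact (mul_eq_left.1 hv'.symm)
  have hnil := loop_eq_nil_of_wordEval_eq_one hL hM (hxuy ▸ hp)
    (by rw [hx, hxu] at hs; exact hs.symm) hu
  rw [hnil, List.length_nil] at hlen
  omega

/-- The centralizer of an element is finitely generated. -/
theorem exists_finite_centralizer_le_closure (hL : IsBiautomaticStructure ev L) (g : G) :
    ∃ S : Set G, S.Finite ∧ S ⊆ Subgroup.centralizer {g} ∧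
      Subgroup.centralizer {g} ≤ Subgroup.closure S := by
  have := hL.finite
  obtain ⟨E, hE, hFT⟩ := fellowTravels hL g g
  -- `X` picks one conjugator for each conjugate of `g`; `X g` need not be `1`, so it joins the
  -- generators.
  have hX : ∀ h : G, ∃ x : G, (∃ y : G, y⁻¹ * g * y = h) → x⁻¹ * g * x = h := fun h => by
    by_cases hy : ∃ y : G, y⁻¹ * g * y = h
    · exact ⟨hy.choose, fun _ => hy.choose_spec⟩
    · exact ⟨1, fun h => (hy h).elim⟩
  choose X hX using hX
  have hXmem : ∀ x : G, x * (X (x⁻¹ * g * x))⁻¹ ∈ Subgroup.centralizer {g} := fun x => by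
    have h := hX (x⁻¹ * g * x) ⟨x, rfl⟩
    rw [Subgroup.mem_centralizer_singleton_iff]
    generalize X (x⁻¹ * g * x) = z at h
    have h' : g * x = x * z⁻¹ * g * z := by
      calc g * x = x * (x⁻¹ * g * x) := by group
        _ = _ := by rw [← h]; group
    rw [← mul_assoc, h']; group
  have hXg : X g ∈ Subgroup.centralizer {g} := by
    have := hXmem 1
    simp only [inv_one, one_mul, mul_one] at this
    exact (Subgroup.inv_mem_iff _).1 this
  refine ⟨insert (X g) ((X '' E * Set.range ev * (X '' E)⁻¹) ∩ Subgroup.centralizer {g}),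
    ?_, ?_, ?_⟩
  · exact ((((hE.image X).mul (Set.finite_range ev)).mul (hE.image X).inv).inter_of_left
      _).insert _
  · exact Set.insert_subset hXg Set.inter_subset_right
  · intro c hc
    obtain ⟨w, hw, rfl⟩ := hL.exists_word c
    rw [Subgroup.mem_centralizer_singleton_iff] at hc
    set S := insert (X g) ((X '' E * Set.range ev * (X '' E)⁻¹) ∩
      (Subgroup.centralizer {g} : Set G)) with hS
    have hXS : X g ∈ Subgroup.closure S := Subgroup.subset_closure (Set.mem_insert _ _)
    -- Each prefix is corrected into the centralizer; consecutive corrections differ by an element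
    -- of `S`.
    have key : ∀ t ≤ w.length, wordEval ev (w.take t) *
        (X ((wordEval ev (w.take t))⁻¹ * g * wordEval ev (w.take t)))⁻¹ ∈
          Subgroup.closure S := by
      intro t
      induction t with
      | zero => intro _; simpa using hXS
      | succ t ih =>
        intro ht
        have ih := ih (by omega)
        have hE₀ := hFT w hw w hw hc.symm t
        have hE₁ := hFT w hw w hw hc.symm (t + 1)
        have hsucc : wordEval ev (w.take (t + 1)) = wordEval ev (w.take t) * ev w[t] := by
          rw [List.take_succ_eq_append_getElem (by omega), wordEval_append, wordEval_cons,
            wordEval_nil, mul_one]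
        have hm := Subgroup.mul_mem _ (Subgroup.inv_mem _ (hXmem (wordEval ev (w.take t))))
          (hXmem (wordEval ev (w.take (t + 1))))
        rw [hsucc] at hm hE₁ ⊢
        generalize wordEval ev (w.take t) = x at *
        have hstep : X (x⁻¹ * g * x) * ev w[t] *
            (X ((x * ev w[t])⁻¹ * g * (x * ev w[t])))⁻¹ ∈ Subgroup.closure S := by
          refine Subgroup.subset_closure (Set.mem_insert_of_mem _ ⟨?_, ?_⟩)
          · exact Set.mul_mem_mul (Set.mul_mem_mul ⟨_, hE₀, rfl⟩ ⟨_, rfl⟩)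
              (Set.inv_mem_inv.2 ⟨_, hE₁, rfl⟩)
          · rw [SetLike.mem_coe]
            convert hm using 1
            group
        convert Subgroup.mul_mem _ ih hstep using 1
        group
    have hlast := key w.length le_rfl
    rw [List.take_length, show (wordEval ev w)⁻¹ * g * wordEval ev w = g by
      rw [mul_assoc, ← hc]; group] at hlast
    simpa using Subgroup.mul_mem _ hlast hXS

end FellowTraveller

/-! ### Simultaneous pumping of loops. -/

section Pumping

variable {G : Type*} [Group G] {A : Type*} {σ : Type*} (ev : A → G) (M : DFA A σ) (S : Set G)

/-- The run of the automaton `M` on a word, started in state `q` at the group element `x`: each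
letter is recorded with the state before it and with the conjugates of the elements of `S` by the
current group element, and the end of the word is marked by `none`. -/
def annotatedRun : σ → G → List A → List (σ × (S → G) × Option A)
  | q, x, [] => [(q, fun s => x⁻¹ * s * x, none)]
  | q, x, a :: w => (q, fun s => x⁻¹ * s * x, some a) :: annotatedRun (M.step q a) (x * ev a) w

variable {S} in
lemma mul_inv_mem_centralizer_of_conj_eq {x y : G}
    (h : (fun s : S => x⁻¹ * s * x) = fun s : S => y⁻¹ * s * y) :
    y * x⁻¹ ∈ Subgroup.centralizer S := by
  rw [Subgroup.mem_centralizer_iff]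
  intro s hs
  have h := congrFun h ⟨s, hs⟩
  simp only at h
  calc s * (y * x⁻¹) = y * (y⁻¹ * s * y) * x⁻¹ := by group
    _ = y * x⁻¹ * s := by rw [← h]; group

lemma exists_take_of_mem_annotatedRun {q : σ} {x : G} {w : List A}
    {e : σ × (S → G) × Option A} (he : e ∈ annotatedRun ev M S q x w) :
    ∃ t : ℕ, e.2.1 =
      fun s : S => (x * wordEval ev (w.take t))⁻¹ * s * (x * wordEval ev (w.take t)) := by
  induction w generalizing q x with
  | nil =>
    simp only [annotatedRun, List.mem_singleton] at he
    exact ⟨0, by simp [he]⟩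
  | cons a w ih =>
    simp only [annotatedRun, List.mem_cons] at he
    rcases he with rfl | he
    · exact ⟨0, by simp⟩
    · obtain ⟨t, ht⟩ := ih he
      exact ⟨t + 1, by simp [ht, mul_assoc]⟩

/-- The word `u` arises from `w` by inserting loops which can be pumped simultaneously. -/
def IsPumpExtension (q : σ) (x : G) (w u : List A) : Prop :=
  ∃ m ∈ Subgroup.centralizer S, x * wordEval ev u = m * (x * wordEval ev w) ∧
    ∀ k : ℕ, ∃ W : List A, W.length + k * w.length = w.length + k * u.length ∧
      M.evalFrom q W = M.evalFrom q w ∧ x * wordEval ev W = m ^ k * (x * wordEval ev w)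

variable {ev M S} in
/-- Inserting a loop in front of a pumpable extension. -/
lemma IsPumpExtension.loop_append
    (hcomm : ∀ m ∈ Subgroup.centralizer S, ∀ m' ∈ Subgroup.centralizer S, m * m' = m' * m)
    {q : σ} {x : G} {w u l : List A} (H : IsPumpExtension ev M S q x w u)
    (hl : M.evalFrom q l = q) (hm : x * wordEval ev l * x⁻¹ ∈ Subgroup.centralizer S) :
    IsPumpExtension ev M S q x w (l ++ u) := by
  obtain ⟨m, hmS, hmu, hW⟩ := H
  refine ⟨x * wordEval ev l * x⁻¹ * m, Subgroup.mul_mem _ hm hmS, ?_, fun k => ?_⟩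
  · rw [mul_assoc _ m, ← hmu, wordEval_append]; group
  · obtain ⟨W, hlen, heval, hval⟩ := hW k
    refine ⟨(List.replicate k l).flatten ++ W, ?_, ?_, ?_⟩
    · rw [List.length_append, length_flatten_replicate, List.length_append, mul_add]
      omega
    · rw [DFA.evalFrom_of_append, evalFrom_flatten_replicate M hl, heval]
    · rw [(show Commute _ _ from hcomm _ hm _ hmS).mul_pow, mul_assoc _ (m ^ k), ← hval,
        wordEval_append, wordEval_flatten_replicate, conj_pow]
      group

variable {ev M S} in
lemma IsPumpExtension.cons {q : σ} {x : G} {a : A} {w u : List A}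
    (H : IsPumpExtension ev M S (M.step q a) (x * ev a) w u) :
    IsPumpExtension ev M S q x (a :: w) (a :: u) := by
  obtain ⟨m, hmS, hmu, hW⟩ := H
  refine ⟨m, hmS, by simpa [mul_assoc] using hmu, fun k => ?_⟩
  obtain ⟨W, hlen, heval, hval⟩ := hW k
  refine ⟨a :: W, ?_, by simpa using heval, by simpa [mul_assoc] using hval⟩
  simp only [List.length_cons, mul_add]
  omega

/-- Letters skipped before a match form `l`, and equal states and conjugates make the later gaps
loops. The `none` marker forces the two ends to match. -/
lemma exists_isPumpExtension_of_sublist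
    (hcomm : ∀ m ∈ Subgroup.centralizer S, ∀ m' ∈ Subgroup.centralizer S, m * m' = m' * m)
    {q q' : σ} {x x' : G} {w w' : List A}
    (h : (annotatedRun ev M S q x w).Sublist (annotatedRun ev M S q' x' w')) :
    ∃ l u : List A, w' = l ++ u ∧ M.evalFrom q' l = q ∧
      x' * wordEval ev l * x⁻¹ ∈ Subgroup.centralizer S ∧ IsPumpExtension ev M S q x w u := by
  induction w' generalizing q x q' x' w with
  | nil =>
    cases w with
    | nil =>
      have := h.eq_of_length rfl
      simp only [annotatedRun, List.cons.injEq, Prod.mk.injEq] at this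
      refine ⟨[], [], rfl, this.1.1.symm, ?_, 1, one_mem _, by simp, fun k => ⟨[], by simp⟩⟩
      simpa using mul_inv_mem_centralizer_of_conj_eq this.1.2.1
    | cons a w =>
      have := h.subset (List.mem_cons_self ..)
      simp [annotatedRun] at this
  | cons b w' ih =>
    rw [annotatedRun] at h
    rcases List.sublist_cons_iff.1 h with h | ⟨r, hr, h⟩
    · obtain ⟨l, u, rfl, hl, hm, hu⟩ := ih h
      exact ⟨b :: l, u, rfl, by simpa using hl, by simpa [mul_assoc] using hm, hu⟩
    · cases w with
      | nil => simp [annotatedRun] at hr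
      | cons a w =>
        simp only [annotatedRun, List.cons.injEq, Prod.mk.injEq, Option.some.injEq] at hr
        obtain ⟨⟨rfl, hc, rfl⟩, rfl⟩ := hr
        have hx := mul_inv_mem_centralizer_of_conj_eq hc
        obtain ⟨l, u, rfl, hl, hm, hu⟩ := ih h
        refine ⟨[], a :: (l ++ u), rfl, rfl, by simpa using hx, (hu.loop_append hcomm hl ?_).cons⟩
        convert Subgroup.mul_mem _ (Subgroup.inv_mem _ hx) hm using 1
        group

end Pumping

/-! ### Linear growth of lengths and the limit. -/

section StableLength

variable {G : Type*} [Group G] {A : Type*} {ev : A → G} {L : Language A}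

/-- There is a finite set of elements commuting with `g` whose centralizer is commutative. -/
lemma exists_finite_commutative_centralizer (hL : IsBiautomaticStructure ev L) (g : G) :
    ∃ S : Set G, S.Finite ∧ S ⊆ Subgroup.centralizer {g} ∧
      ∀ m ∈ Subgroup.centralizer S, ∀ m' ∈ Subgroup.centralizer S, m * m' = m' * m := by
  obtain ⟨S, hS, hSg, hgen⟩ := exists_finite_centralizer_le_closure hL g
  refine ⟨insert g S, hS.insert g, Set.insert_subset ?_ hSg, fun m hm m' hm' => ?_⟩
  · simp [Subgroup.mem_centralizer_singleton_iff]
  -- Having `g` in the set puts `m` in the group generated by `S`, which `m'` centralizes.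
  · have hmg : m ∈ Subgroup.centralizer {g} :=
      Subgroup.centralizer_le (Set.singleton_subset_iff.2 (Set.mem_insert g S)) hm
    have hm'S : Subgroup.closure S ≤ Subgroup.centralizer {m'} := by
      rw [Subgroup.closure_le]
      intro s hs
      rw [SetLike.mem_coe, Subgroup.mem_centralizer_singleton_iff]
      exact Subgroup.mem_centralizer_iff.1 hm' s (Set.mem_insert_of_mem _ hs)
    exact Subgroup.mem_centralizer_singleton_iff.1 (hm'S (hgen hmg))

/-- Powers of `g` in some arithmetic progression are represented by words in `L` whose lengths
form an arithmetic progression. -/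
theorem exists_arithmetic_words (hL : IsBiautomaticStructure ev L) (g : G) :
    ∃ n₀ d a b : ℕ, 0 < d ∧ ∀ k : ℕ, ∃ W ∈ L, wordEval ev W = g ^ (n₀ + k * d) ∧
      W.length + k * a = a + k * b := by
  have := hL.finite
  obtain ⟨σ, _, M, hM⟩ := hL.regular
  obtain ⟨S, hS, hSg, hcomm⟩ := exists_finite_commutative_centralizer hL g
  have hSg' : ∀ s ∈ S, ∀ n : ℕ, s * g ^ n = g ^ n * s := fun s hs n =>
    (show Commute s g from Subgroup.mem_centralizer_singleton_iff.1 (hSg hs)).pow_right n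
  have : Finite S := hS
  choose w hwL hw using fun n : ℕ => hL.exists_word (g ^ n)
  choose E hE hFT using fun s : G => fellowTravels hL s s
  have hletters : ({e : σ × (S → G) × Option A | ∀ s : S, e.2.1 s ∈ E s}).Finite := by
    have h1 : {f : S → G | ∀ s : S, f s ∈ E s}.Finite := Set.Finite.pi' fun s : S => hE s
    have h2 := (Set.finite_univ (α := σ)).prod (h1.prod (Set.finite_univ (α := Option A)))
    exact h2.subset fun e he => ⟨trivial, he, trivial⟩
  -- Higman's lemma over a finite alphabet, with equality as the order on letters.
  have hhigman := Set.PartiallyWellOrderedOn.partiallyWellOrderedOn_sublistForall₂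
    (· = ·) (hletters.partiallyWellOrderedOn (r := (· = ·)))
  obtain ⟨i, j, hij, hsub⟩ := Set.partiallyWellOrderedOn_iff_exists_lt.1 hhigman
    (fun n => annotatedRun ev M S M.start 1 (w n)) (fun n e he s => by
      obtain ⟨t, ht⟩ := exists_take_of_mem_annotatedRun ev M S he
      rw [ht]
      simpa using hFT s (w n) (hwL n) (w n) (hwL n) (by rw [hw, hSg' s s.2]) t)
  have hsub' : (annotatedRun ev M S M.start 1 (w i)).Sublist
      (annotatedRun ev M S M.start 1 (w j)) := by
    obtain ⟨l, hl, hls⟩ := List.sublistForall₂_iff.1 hsub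
    rw [List.forall₂_eq_eq_eq] at hl
    rwa [hl]
  obtain ⟨l, u, hlu, hl, hlm, hu⟩ := exists_isPumpExtension_of_sublist ev M S hcomm hsub'
  have hext := hu.loop_append hcomm hl hlm
  rw [← hlu] at hext
  obtain ⟨m, -, hm, hW⟩ := hext
  refine ⟨i, j - i, (w i).length, (w j).length, by omega, fun k => ?_⟩
  obtain ⟨W, hlen, heval, hval⟩ := hW k
  refine ⟨W, ?_, ?_, hlen⟩
  · rw [← hM, DFA.mem_accepts, DFA.eval, heval]
    have := hwL i
    rwa [← hM, DFA.mem_accepts] at this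
  · simp only [one_mul, hw] at hm hval
    have hmg : m = g ^ (j - i) := by
      rw [eq_comm, ← mul_left_inj (g ^ i), ← hm, ← pow_add]
      congr 1
      omega
    rw [hval, hmg, ← pow_mul, ← pow_add]
    congr 1
    ring

/-- The lengths of all words in `L` representing `g ^ n` agree with a rational linear function
of `n` up to a bounded error. -/
theorem exists_rat_abs_length_sub_le (hL : IsBiautomaticStructure ev L) (g : G) :
    ∃ (r : ℚ) (C : ℝ) (n₀ : ℕ), ∀ n ≥ n₀, ∀ v ∈ L, wordEval ev v = g ^ n →
      |(v.length : ℝ) - n * r| ≤ C := by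
  obtain ⟨n₀, d, a, b, hd, hW⟩ := exists_arithmetic_words hL g
  choose C₁ hC₁ using fun i : ℕ => exists_length_le_add hL (g ^ i) 1
  choose C₂ hC₂ using fun i : ℕ => exists_length_le_add hL (g ^ i)⁻¹ 1
  -- A single bound for all residues `i < d`.
  let C := ∑ i ∈ Finset.range d, (C₁ i + C₂ i)
  refine ⟨((b : ℚ) - a) / d, C + a + (n₀ + d) * |((b : ℝ) - a) / d|, n₀,
    fun n hn v hv hvg => ?_⟩
  obtain ⟨k, i, hi, rfl⟩ : ∃ k i, i < d ∧ n = i + (n₀ + k * d) := by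
    refine ⟨(n - n₀) / d, (n - n₀) % d, Nat.mod_lt _ hd, ?_⟩
    have := Nat.mod_add_div (n - n₀) d
    rw [mul_comm d] at this
    omega
  obtain ⟨W, hWL, hWg, hlen⟩ := hW k
  have h1 := hC₁ i v hv W hWL (by rw [hvg, hWg, mul_one, ← pow_add])
  have h2 := hC₂ i W hWL v hv (by rw [hvg, hWg, mul_one, pow_add]; group)
  have hC : C₁ i + C₂ i ≤ C :=
    Finset.single_le_sum (f := fun i => C₁ i + C₂ i) (fun _ _ => Nat.zero_le _)
      (Finset.mem_range.2 hi)
  have h1' : (v.length : ℝ) ≤ W.length + C := by exact_mod_cast (by omega)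
  have h2' : (W.length : ℝ) ≤ v.length + C := by exact_mod_cast (by omega)
  have hlen' : (W.length : ℝ) + k * a = a + k * b := by exact_mod_cast hlen
  have hd' : (d : ℝ) ≠ 0 := by positivity
  set r : ℝ := ((b : ℝ) - a) / d with hr
  have hrd : d * r = b - a := by rw [hr]; field_simp
  have hcast : (((((b : ℚ) - a) / d : ℚ)) : ℝ) = r := by push_cast; rfl
  rw [hcast]
  have hsplit : (v.length : ℝ) - ((i + (n₀ + k * d) : ℕ) : ℝ) * r =
      (v.length - W.length) + a - (n₀ + i) * r := by
    push_cast
    linear_combination hlen' - k * hrd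
  have hi' : (i : ℝ) ≤ d := by exact_mod_cast hi.le
  have hb : |((n₀ : ℝ) + i) * r| ≤ (n₀ + d) * |r| := by
    rw [abs_mul, abs_of_nonneg (by positivity)]
    gcongr
  rw [hsplit]
  have ha : (0 : ℝ) ≤ a := by positivity
  rw [abs_le] at hb ⊢
  constructor <;> linarith [hb.1, hb.2]

lemma tendsto_div_of_abs_sub_le {f : ℕ → ℝ} {r C : ℝ} {n₀ : ℕ}
    (h : ∀ n ≥ n₀, |f n - n * r| ≤ C) : Tendsto (fun n : ℕ => f n / n) atTop (𝓝 r) := by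
  rw [tendsto_iff_norm_sub_tendsto_zero]
  refine squeeze_zero' (Eventually.of_forall fun _ => norm_nonneg _) ?_
    (tendsto_const_div_atTop_nhds_zero_nat C)
  filter_upwards [eventually_ge_atTop n₀, eventually_gt_atTop 0] with n hn hpos
  have hpos' : (0 : ℝ) < n := by exact_mod_cast hpos
  rw [Real.norm_eq_abs, show f n / n - r = (f n - n * r) / n by field_simp, abs_div,
    abs_of_pos hpos']
  gcongr
  exact h n hn

lemma exists_word_length_eq_wordLength (hL : IsBiautomaticStructure ev L) (h : G) :
    ∃ w ∈ L, wordEval ev w = h ∧ w.length = wordLength ev L h := by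
  obtain ⟨w, hw, hwh⟩ := hL.exists_word h
  exact Nat.sInf_mem (s := {n : ℕ | ∃ w ∈ L, wordEval ev w = h ∧ w.length = n})
    ⟨w.length, w, hw, hwh, rfl⟩

end StableLength

end Biaut

theorem mainTheorem6 {G : Type*} [Group G] {A : Type*} (ev : A → G) (L : Language A)
    (hL : Biaut.IsBiautomaticStructure ev L) (g : G) :
    (∀ w : ℕ → List A, (∀ n : ℕ, 1 ≤ n → w n ∈ L ∧ Biaut.wordEval ev (w n) = g ^ n) →
      (∃ q : ℚ, Tendsto (fun n : ℕ => ((w n).length : ℝ) / n) atTop (𝓝 (q : ℝ))) ∧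
      Tendsto (fun n : ℕ => ((w n).length : ℝ) / n) atTop (𝓝 (Biaut.stableLength ev L g))) ∧
    Tendsto (fun n : ℕ => (Biaut.wordLength ev L (g ^ n) : ℝ) / n) atTop
      (𝓝 (Biaut.stableLength ev L g)) ∧
    ∃ q : ℚ, Biaut.stableLength ev L g = (q : ℝ) := by
  obtain ⟨r, C, n₀, hr⟩ := Biaut.exists_rat_abs_length_sub_le hL g
  have hall : ∀ w : ℕ → List A,
      (∀ n : ℕ, 1 ≤ n → w n ∈ L ∧ Biaut.wordEval ev (w n) = g ^ n) →
      Tendsto (fun n : ℕ => ((w n).length : ℝ) / n) atTop (𝓝 (r : ℝ)) := fun w hw =>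
    Biaut.tendsto_div_of_abs_sub_le (f := fun n => ((w n).length : ℝ)) (n₀ := max 1 n₀)
      fun n hn => hr n (le_of_max_le_right hn) (w n) (hw n (le_of_max_le_left hn)).1
        (hw n (le_of_max_le_left hn)).2
  choose v hvL hv hvlen using fun n : ℕ =>
    Biaut.exists_word_length_eq_wordLength hL (g ^ n)
  have hshort : Tendsto (fun n : ℕ => (Biaut.wordLength ev L (g ^ n) : ℝ) / n) atTop
      (𝓝 (r : ℝ)) := by
    simpa only [hvlen] using hall v fun n _ => ⟨hvL n, hv n⟩
  have hstable : Biaut.stableLength ev L g = r := hshort.limUnder_eq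
  rw [hstable]
  exact ⟨fun w hw => ⟨⟨r, hall w hw⟩, hall w hw⟩, hshort, r, rfl⟩
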